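/- Let $k,n\ge 0$ be integers, and identify $\mathbb{RP}^1=\mathbb R\cup\{\infty\}$. Let $M$ be a real-analytic manifold of dimension $k(n+1)$ and let $\{w(t)\}_{t\in\mathbb{RP}^1}$ be a family of real-analytic distributions of codimension $k$ on $M$ (subbundles $w(t)\subset TM$ of rank $kn$). Assume that $\{w(t)\}$ is a generalized Veronese curve: near every point of $M$ there is a real-analytic coframe $\{\gamma^i_j : 1\le i\le k,\ 0\le j\le n\}$ such that for every $t\in\mathbb{RP}^1$ the distribution $w(t)$ is the common kernel of the $k$ independent $1$-forms $\gamma^1(t),\dots,\gamma^k(t)$, where $$\gamma^i(t)=\gamma^i_0+t\gamma^i_1+\cdots+t^n\gamma^i_n\quad(t\in\mathbb R),\qquad \gamma^i(\infty)=\gamma^i_n .$$ A distribution $D$ of codimension $k$ is called integrable if near every point it is the common kernel of $k$ independent real-analytic $1$-forms $\theta^1,\dots,\theta^k$ with $d\theta^i=\sum_{s=1}^k\beta^i_s\wedge\theta^s$, $1\le i\le k$, for some real-analytic $1$-forms $\beta^i_s$. Suppose that $w(a_0),\dots,w(a_{n+2})$ are integrable for $n+3$ pairwise distinct points $a_0,\dots,a_{n+2}\in\mathbb{RP}^1$.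 Then $w(t)$ is integrable for every $t\in\mathbb{RP}^1$, i.e. $\{w(t)\}$ is a generalized Veronese web. (The case $k=1$ is Zakharevich's conjecture on Veronese curves of distributions.) -/

import Mathlib

open scoped Manifold ContDiff

namespace Veronese

section Definitions

/-- A (rough) differential 1-form on a manifold `M` of dimension `m`: a choice of a covector at
every point. Only its restriction to an open set where it is analytic is ever used. -/
abbrev OneForm (m : ℕ) (M : Type*) [TopologicalSpace M]
    [ChartedSpace (EuclideanSpace ℝ (Fin m)) M] : Type _ :=
  (x : M) → TangentSpace (𝓡 m) x →L[ℝ] ℝ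

variable {m : ℕ} {M : Type*} [TopologicalSpace M] [ChartedSpace (EuclideanSpace ℝ (Fin m)) M]

/-- The 1-form `γ` is real-analytic on `U`, as a section of the cotangent bundle
`Hom(TM, M × ℝ)`. -/
def OneForm.AnalyticOn [IsManifold (𝓡 m) ω M] (γ : OneForm m M) (U : Set M) : Prop :=
  ContMDiffOn (𝓡 m) ((𝓡 m).prod 𝓘(ℝ, EuclideanSpace ℝ (Fin m) →L[ℝ] ℝ)) ω
    (fun x => Bundle.TotalSpace.mk' (EuclideanSpace ℝ (Fin m) →L[ℝ] ℝ)
      (E := fun x : M => TangentSpace (𝓡 m) x →L[ℝ] Bundle.Trivial M ℝ x) x (γ x)) U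

/-- The 1-form `γ` read in the preferred chart `φ` at `x₀`, i.e. the pullback of `γ` by `φ⁻¹`. -/
noncomputable def OneForm.inChart (γ : OneForm m M) (x₀ : M) (y : EuclideanSpace ℝ (Fin m)) :
    EuclideanSpace ℝ (Fin m) →L[ℝ] ℝ :=
  (γ ((extChartAt (𝓡 m) x₀).symm y)).comp
    (mfderiv 𝓘(ℝ, EuclideanSpace ℝ (Fin m)) (𝓡 m) (extChartAt (𝓡 m) x₀).symm y)

/-- The exterior derivative of a 1-form, `dγ(u, v) = (D_u γ)(v) - (D_v γ)(u)`, computed at `x₀` in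
the preferred chart at `x₀`. -/
noncomputable def OneForm.d (γ : OneForm m M) (x₀ : M) (u v : TangentSpace (𝓡 m) x₀) : ℝ :=
  let u' : EuclideanSpace ℝ (Fin m) :=
    mfderiv (𝓡 m) 𝓘(ℝ, EuclideanSpace ℝ (Fin m)) (extChartAt (𝓡 m) x₀) x₀ u
  let v' : EuclideanSpace ℝ (Fin m) :=
    mfderiv (𝓡 m) 𝓘(ℝ, EuclideanSpace ℝ (Fin m)) (extChartAt (𝓡 m) x₀) x₀ v
  fderiv ℝ (γ.inChart x₀) (extChartAt (𝓡 m) x₀ x₀) u' v' -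
    fderiv ℝ (γ.inChart x₀) (extChartAt (𝓡 m) x₀ x₀) v' u'

/-- The wedge product of two 1-forms, `(α ∧ β)(u, v) = α(u) β(v) - α(v) β(u)`. -/
noncomputable def OneForm.wedge (α β : OneForm m M) (x : M) (u v : TangentSpace (𝓡 m) x) : ℝ :=
  α x u * β x v - α x v * β x u

variable [IsManifold (𝓡 m) ω M]

/-- On `U`, the 1-forms `θ¹, …, θᵏ` are analytic and linearly independent at each point, and
`D` is the field of their common kernels. -/
structure IsAnnihilatingFrameOn {k : ℕ} (D : (x : M) → Submodule ℝ (TangentSpace (𝓡 m) x))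
    (θ : Fin k → OneForm m M) (U : Set M) : Prop where
  analyticOn : ∀ i, (θ i).AnalyticOn U
  linearIndependent : ∀ x ∈ U, LinearIndependent ℝ (fun i => θ i x)
  mem_iff : ∀ x ∈ U, ∀ v : TangentSpace (𝓡 m) x, v ∈ D x ↔ ∀ i, θ i x v = 0

variable (m M) in
/-- A real-analytic distribution of codimension `k`: a subbundle of `TM` which locally is the
common kernel of `k` pointwise linearly independent analytic 1-forms. -/
structure TangentDistribution (k : ℕ) where
  /-- the subspace of the tangent space at each point -/
  fiber : (x : M) → Submodule ℝ (TangentSpace (𝓡 m) x)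
  exists_annihilatingFrame : ∀ x : M, ∃ U : Set M, IsOpen U ∧ x ∈ U ∧
    ∃ θ : Fin k → OneForm m M, IsAnnihilatingFrameOn fiber θ U

/-- Integrability of a distribution, in Frobenius' form: near every point there are independent
1-forms `θ¹, …, θᵏ` cutting out the distribution and analytic 1-forms `βⁱₛ` with
`dθⁱ = ∑ₛ βⁱₛ ∧ θˢ`. -/
def TangentDistribution.IsIntegrable {k : ℕ} (D : TangentDistribution m M k) : Prop :=
  ∀ x : M, ∃ U : Set M, IsOpen U ∧ x ∈ U ∧
    ∃ θ : Fin k → OneForm m M, IsAnnihilatingFrameOn D.fiber θ U ∧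
      ∃ β : Fin k → Fin k → OneForm m M, (∀ i s, (β i s).AnalyticOn U) ∧
        ∀ y ∈ U, ∀ i, ∀ u v : TangentSpace (𝓡 m) y,
          (θ i).d y u v = ∑ s, (β i s).wedge (θ s) y u v

/-- The form `γ(t) = γ₀ + t γ₁ + ⋯ + tⁿ γₙ` for real `t`, and `γ(∞) = γₙ`. Here the projective
line is `ℝ ∪ {∞}`. -/
noncomputable def veroneseForm {n : ℕ} (γ : Fin (n + 1) → OneForm m M) :
    OnePoint ℝ → OneForm m M
  | none => γ (Fin.last n)
  | some t => fun x => ∑ j : Fin (n + 1), t ^ (j : ℕ) • γ j x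

/-- A family `w(t)` of codimension `k` distributions on a manifold of dimension `k (n + 1)`,
indexed by the projective line, is a generalized Veronese curve: near every point there is an
analytic coframe `γⁱⱼ` such that, for every `t`, the distribution `w(t)` is cut out by the `k`
independent forms `γⁱ(t) = ∑ⱼ tʲ γⁱⱼ`. -/
def IsGeneralizedVeroneseCurve {k : ℕ} (n : ℕ) {M : Type*} [TopologicalSpace M]
    [ChartedSpace (EuclideanSpace ℝ (Fin (k * (n + 1)))) M]
    [IsManifold (𝓡 (k * (n + 1))) ω M]
    (w : OnePoint ℝ → TangentDistribution (k * (n + 1)) M k) : Prop :=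
  ∀ x : M, ∃ U : Set M, IsOpen U ∧ x ∈ U ∧
    ∃ γ : Fin k → Fin (n + 1) → OneForm (k * (n + 1)) M,
      (∀ i j, (γ i j).AnalyticOn U) ∧
      (∀ y ∈ U, LinearIndependent ℝ (fun p : Fin k × Fin (n + 1) => γ p.1 p.2 y)) ∧
      ∀ t : OnePoint ℝ, IsAnnihilatingFrameOn (w t).fiber (fun i => veroneseForm (γ i) t) U

/-- A generalized Veronese web: a generalized Veronese curve all of whose distributions are
integrable. -/
structure IsGeneralizedVeroneseWeb {k : ℕ} (n : ℕ) {M : Type*} [TopologicalSpace M]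
    [ChartedSpace (EuclideanSpace ℝ (Fin (k * (n + 1)))) M]
    [IsManifold (𝓡 (k * (n + 1))) ω M]
    (w : OnePoint ℝ → TangentDistribution (k * (n + 1)) M k) : Prop where
  isCurve : IsGeneralizedVeroneseCurve n w
  isIntegrable : ∀ t, (w t).IsIntegrable

end Definitions

end Veronese

/-! By Frobenius, integrability of a distribution says that the exterior derivatives of its defining
forms vanish on it. This is independent of the defining forms and pointwise, so the theorem reduces
to linear algebra at one point, for one index `i` at a time.

At a point the coframe gives coordinates `c i j` on the tangent space, and a vector lies in `w(t)`
when each polynomial `∑ j, c i j * x ^ j` vanishes at `t`, that is, equals `(x - t) * e i` with `e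
i` of degree below `n` (`exists_cons_sub_snoc`). Hence the vector is `A - t B`, where `A` and `B`
encode `x * e i` and `e i`; keeping `e` fixed, `A - s B` lies in `w(s)` for every `s`.

For two such pairs, `dγ(s)(A - s B, A' - s B')` is a polynomial in `s` of degree at most `n + 2`:
degree `n` from `γ(s)` and one from each argument. It vanishes at `n + 3` points of the projective
line, hence identically (`sum_veroneseCoeff_bilin_eq_zero`). Homogeneous coordinates `num`, `den`
cover `s = ∞`. -/

namespace Veronese

/-! ### Analytic 1-forms in charts -/

section Charts

open Set Filter Topology

variable {m : ℕ} {M : Type*} [TopologicalSpace M] [ChartedSpace (EuclideanSpace ℝ (Fin m)) M]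
  [IsManifold (𝓡 m) ω M]

theorem OneForm.trivializationAt_apply (γ : OneForm m M) {x₀ p : M}
    (hp : p ∈ (chartAt (EuclideanSpace ℝ (Fin m)) x₀).source) :
    (trivializationAt (EuclideanSpace ℝ (Fin m) →L[ℝ] ℝ)
      (fun x : M => TangentSpace (𝓡 m) x →L[ℝ] Bundle.Trivial M ℝ x) x₀ ⟨p, γ p⟩).2 =
      γ.inChart x₀ (extChartAt (𝓡 m) x₀ p) := by
  rw [hom_trivializationAt_apply]
  simp only [ContinuousLinearMap.inCoordinates, OneForm.inChart]
  rw [TangentBundle.symmL_trivializationAt hp,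
    (extChartAt (𝓡 m) x₀).left_inv (by rwa [extChartAt_source])]
  simp only [modelWithCornersSelf_coe, range_id, mfderivWithin_univ]
  ext v
  simp

theorem OneForm.analyticOn_iff (γ : OneForm m M) {x₀ : M} {U : Set M}
    (hU : U ⊆ (chartAt (EuclideanSpace ℝ (Fin m)) x₀).source) :
    γ.AnalyticOn U ↔
      ContMDiffOn (𝓡 m) 𝓘(ℝ, EuclideanSpace ℝ (Fin m) →L[ℝ] ℝ) ω
        (fun p => γ.inChart x₀ (extChartAt (𝓡 m) x₀ p)) U := by
  rw [OneForm.AnalyticOn, Bundle.Trivialization.contMDiffOn_iff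
    (e := trivializationAt (EuclideanSpace ℝ (Fin m) →L[ℝ] ℝ)
      (fun x : M => TangentSpace (𝓡 m) x →L[ℝ] Bundle.Trivial M ℝ x) x₀)]
  · refine ⟨fun h => h.2.congr fun p hp => (γ.trivializationAt_apply (hU hp)).symm,
      fun h => ⟨contMDiffOn_id, h.congr fun p hp => γ.trivializationAt_apply (hU hp)⟩⟩
  · intro p hp
    simpa using hU hp

theorem OneForm.AnalyticOn.contDiffAt_inChart {γ : OneForm m M} {U : Set M}
    (h : γ.AnalyticOn U) (hU : IsOpen U) {x₀ p : M} (hp : p ∈ U)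
    (hps : p ∈ (chartAt (EuclideanSpace ℝ (Fin m)) x₀).source) :
    ContDiffAt ℝ ω (γ.inChart x₀) (extChartAt (𝓡 m) x₀ p) := by
  have hV : γ.AnalyticOn (U ∩ (chartAt (EuclideanSpace ℝ (Fin m)) x₀).source) :=
    ContMDiffOn.mono h inter_subset_left
  have h1 := ((γ.analyticOn_iff inter_subset_right).1 hV).contMDiffAt
    ((hU.inter (chartAt _ x₀).open_source).mem_nhds ⟨hp, hps⟩)
  have hps' : p ∈ (extChartAt (𝓡 m) x₀).source := by rwa [extChartAt_source]
  have ht := (extChartAt (𝓡 m) x₀).map_source hps'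
  have hopen : (extChartAt (𝓡 m) x₀).target ∈ 𝓝 (extChartAt (𝓡 m) x₀ p) :=
    (isOpen_extChartAt_target x₀).mem_nhds ht
  have h2 : ContMDiffAt 𝓘(ℝ, EuclideanSpace ℝ (Fin m)) (𝓡 m) ω (extChartAt (𝓡 m) x₀).symm
      (extChartAt (𝓡 m) x₀ p) := (contMDiffOn_extChartAt_symm x₀).contMDiffAt hopen
  have h3 := ContMDiffAt.comp_of_eq (x := extChartAt (𝓡 m) x₀ p) h1 h2
    ((extChartAt (𝓡 m) x₀).left_inv hps')
  refine (contMDiffAt_iff_contDiffAt.1 h3).congr_of_eventuallyEq ?_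
  filter_upwards [hopen] with z hz
  rw [Function.comp_apply, (extChartAt (𝓡 m) x₀).right_inv hz]

/-- The 1-form on the chart domain at `x₀` with local expression `b`. -/
noncomputable def OneForm.ofChart (x₀ : M)
    (b : EuclideanSpace ℝ (Fin m) → EuclideanSpace ℝ (Fin m) →L[ℝ] ℝ) : OneForm m M :=
  fun p => (b (extChartAt (𝓡 m) x₀ p)).comp
    (mfderiv (𝓡 m) 𝓘(ℝ, EuclideanSpace ℝ (Fin m)) (extChartAt (𝓡 m) x₀) p)

theorem mfderiv_extChartAt_mfderiv_symm {x₀ : M} {z : EuclideanSpace ℝ (Fin m)}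
    (hz : z ∈ (extChartAt (𝓡 m) x₀).target) (v : EuclideanSpace ℝ (Fin m)) :
    mfderiv (𝓡 m) 𝓘(ℝ, EuclideanSpace ℝ (Fin m)) (extChartAt (𝓡 m) x₀)
      ((extChartAt (𝓡 m) x₀).symm z)
      (mfderiv 𝓘(ℝ, EuclideanSpace ℝ (Fin m)) (𝓡 m) (extChartAt (𝓡 m) x₀).symm z v) = v := by
  have := mfderiv_extChartAt_comp_mfderivWithin_extChartAt_symm (I := 𝓡 m) hz
  simp only [modelWithCornersSelf_coe, range_id, mfderivWithin_univ] at this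
  exact DFunLike.congr_fun this v

theorem mfderiv_symm_mfderiv_extChartAt {x₀ p : M}
    (hp : p ∈ (extChartAt (𝓡 m) x₀).source) (v : TangentSpace (𝓡 m) p) :
    mfderiv 𝓘(ℝ, EuclideanSpace ℝ (Fin m)) (𝓡 m) (extChartAt (𝓡 m) x₀).symm
      (extChartAt (𝓡 m) x₀ p)
      (mfderiv (𝓡 m) 𝓘(ℝ, EuclideanSpace ℝ (Fin m)) (extChartAt (𝓡 m) x₀) p v) =
      (v : EuclideanSpace ℝ (Fin m)) := by
  have := mfderivWithin_extChartAt_symm_comp_mfderiv_extChartAt' (I := 𝓡 m) hp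
  simp only [modelWithCornersSelf_coe, range_id, mfderivWithin_univ] at this
  exact DFunLike.congr_fun this v

theorem OneForm.inChart_ofChart (x₀ : M)
    (b : EuclideanSpace ℝ (Fin m) → EuclideanSpace ℝ (Fin m) →L[ℝ] ℝ)
    {z : EuclideanSpace ℝ (Fin m)} (hz : z ∈ (extChartAt (𝓡 m) x₀).target) :
    (OneForm.ofChart x₀ b).inChart x₀ z = b z := by
  ext v
  simp only [OneForm.inChart, OneForm.ofChart]
  refine (congrArg (b _) (mfderiv_extChartAt_mfderiv_symm hz v)).trans ?_
  rw [(extChartAt (𝓡 m) x₀).right_inv hz]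

theorem OneForm.analyticOn_ofChart (x₀ : M)
    {b : EuclideanSpace ℝ (Fin m) → EuclideanSpace ℝ (Fin m) →L[ℝ] ℝ} {U : Set M}
    (hU : U ⊆ (chartAt (EuclideanSpace ℝ (Fin m)) x₀).source)
    (hb : ∀ p ∈ U, ContDiffAt ℝ ω b (extChartAt (𝓡 m) x₀ p)) :
    (OneForm.ofChart x₀ b).AnalyticOn U := by
  rw [OneForm.analyticOn_iff _ hU]
  have h : ContMDiffOn (𝓡 m) 𝓘(ℝ, EuclideanSpace ℝ (Fin m) →L[ℝ] ℝ) ω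
      (fun p => b (extChartAt (𝓡 m) x₀ p)) U := fun p hp =>
    (ContMDiffAt.comp p (hb p hp).contMDiffAt (contMDiffAt_extChartAt' (hU hp))).contMDiffWithinAt
  refine h.congr fun p hp => OneForm.inChart_ofChart x₀ b ?_
  exact (extChartAt (𝓡 m) x₀).map_source (by rw [extChartAt_source]; exact hU hp)

/-- The value of a 1-form at `p`, in terms of its local expression in the chart at `x₀`. -/
theorem OneForm.inChart_apply_mfderiv (γ : OneForm m M) {x₀ p : M}
    (hp : p ∈ (extChartAt (𝓡 m) x₀).source) (v : TangentSpace (𝓡 m) p) :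
    γ.inChart x₀ (extChartAt (𝓡 m) x₀ p)
      (mfderiv (𝓡 m) 𝓘(ℝ, EuclideanSpace ℝ (Fin m)) (extChartAt (𝓡 m) x₀) p v) = γ p v := by
  have h := mfderiv_symm_mfderiv_extChartAt hp v
  have h2 := (extChartAt (𝓡 m) x₀).left_inv hp
  simp only [OneForm.inChart]
  refine (congrArg (γ _) h).trans ?_
  rw [h2]

end Charts

/-! ### Exterior derivative: pullback and independence of the chart -/

section Pullback

variable {E F : Type*} [NormedAddCommGroup E] [NormedSpace ℝ E] [NormedAddCommGroup F]
  [NormedSpace ℝ F]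

/-- The exterior derivative of a 1-form commutes with pullback. -/
theorem fderiv_pullback_antisymm {g : F → F →L[ℝ] ℝ} {τ : E → F} {z : E}
    (hτ : ContDiffAt ℝ ω τ z) (hg : DifferentiableAt ℝ g (τ z)) (u v : E) :
    fderiv ℝ (fun z => (g (τ z)).comp (fderiv ℝ τ z)) z u v -
        fderiv ℝ (fun z => (g (τ z)).comp (fderiv ℝ τ z)) z v u =
      fderiv ℝ g (τ z) (fderiv ℝ τ z u) (fderiv ℝ τ z v) -
        fderiv ℝ g (τ z) (fderiv ℝ τ z v) (fderiv ℝ τ z u) := by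
  have hτ1 : DifferentiableAt ℝ τ z := hτ.differentiableAt (by simp)
  have hτ2 : DifferentiableAt ℝ (fderiv ℝ τ) z :=
    (hτ.fderiv_right (m := 1) (by simp)).differentiableAt (by simp)
  have hgτ : HasFDerivAt (fun z => g (τ z)) ((fderiv ℝ g (τ z)).comp (fderiv ℝ τ z)) z :=
    hg.hasFDerivAt.comp z hτ1.hasFDerivAt
  -- The extra term `g (D²τ u v)` is symmetric, so it cancels on antisymmetrizing.
  have hsymm := hτ.isSymmSndFDerivAt_of_omega u v
  have h := (hgτ.clm_comp hτ2.hasFDerivAt).fderiv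
  rw [h]
  simp [hsymm]

end Pullback

section ExteriorDerivative

open Set Filter Topology

variable {m : ℕ} {M : Type*} [TopologicalSpace M] [ChartedSpace (EuclideanSpace ℝ (Fin m)) M]
  [IsManifold (𝓡 m) ω M]

/-- The exterior derivative may be computed in any chart of the atlas. -/
theorem OneForm.d_eq_of_mem_source {γ : OneForm m M} {x₀ y : M}
    (hy : y ∈ (extChartAt (𝓡 m) x₀).source)
    (hγ : DifferentiableAt ℝ (γ.inChart x₀) (extChartAt (𝓡 m) x₀ y))
    (u v : TangentSpace (𝓡 m) y) :
    γ.d y u v =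
      fderiv ℝ (γ.inChart x₀) (extChartAt (𝓡 m) x₀ y)
          (mfderiv (𝓡 m) 𝓘(ℝ, EuclideanSpace ℝ (Fin m)) (extChartAt (𝓡 m) x₀) y u)
          (mfderiv (𝓡 m) 𝓘(ℝ, EuclideanSpace ℝ (Fin m)) (extChartAt (𝓡 m) x₀) y v) -
        fderiv ℝ (γ.inChart x₀) (extChartAt (𝓡 m) x₀ y)
          (mfderiv (𝓡 m) 𝓘(ℝ, EuclideanSpace ℝ (Fin m)) (extChartAt (𝓡 m) x₀) y v)
          (mfderiv (𝓡 m) 𝓘(ℝ, EuclideanSpace ℝ (Fin m)) (extChartAt (𝓡 m) x₀) y u) := by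
  have hyy : y ∈ (extChartAt (𝓡 m) y).source := mem_extChartAt_source y
  have hinv := (extChartAt (𝓡 m) y).left_inv hyy
  -- `d` at `y` uses the preferred chart at `y`; `τ` is the transition map from it to the chart at
  -- `x₀`.
  set τ : EuclideanSpace ℝ (Fin m) → EuclideanSpace ℝ (Fin m) :=
    extChartAt (𝓡 m) x₀ ∘ (extChartAt (𝓡 m) y).symm with hτ
  have hnear : ∀ᶠ z in 𝓝 (extChartAt (𝓡 m) y y), z ∈ (extChartAt (𝓡 m) y).target ∧
      (extChartAt (𝓡 m) y).symm z ∈ (extChartAt (𝓡 m) x₀).source := by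
    refine Filter.Eventually.and (extChartAt_target_mem_nhds y) ?_
    apply (continuousAt_extChartAt_symm y).eventually_mem
    rw [hinv]
    exact (isOpen_extChartAt_source x₀).mem_nhds hy
  have hmd : ∀ z, z ∈ (extChartAt (𝓡 m) y).target →
      (extChartAt (𝓡 m) y).symm z ∈ (extChartAt (𝓡 m) x₀).source → ∀ w,
      fderiv ℝ τ z w = mfderiv (𝓡 m) 𝓘(ℝ, EuclideanSpace ℝ (Fin m)) (extChartAt (𝓡 m) x₀)
        ((extChartAt (𝓡 m) y).symm z)
        (mfderiv 𝓘(ℝ, EuclideanSpace ℝ (Fin m)) (𝓡 m) (extChartAt (𝓡 m) y).symm z w) := by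
    intro z hz hz' w
    rw [extChartAt_source] at hz'
    have h1 := mdifferentiableAt_extChartAt (I := 𝓡 m) hz'
    have h2 : MDifferentiableAt 𝓘(ℝ, EuclideanSpace ℝ (Fin m)) (𝓡 m)
        (extChartAt (𝓡 m) y).symm z :=
      (mdifferentiableOn_extChartAt_symm z hz).mdifferentiableAt
        ((isOpen_extChartAt_target y).mem_nhds hz)
    have h3 := mfderiv_comp z h1 h2
    rw [← mfderiv_eq_fderiv]
    exact DFunLike.congr_fun h3 w
  have hτsmooth : ContDiffAt ℝ ω τ (extChartAt (𝓡 m) y y) := by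
    rw [← contMDiffAt_iff_contDiffAt]
    refine ContMDiffAt.comp_of_eq (contMDiffAt_extChartAt' ?_)
      ((contMDiffOn_extChartAt_symm y).contMDiffAt (extChartAt_target_mem_nhds y)) hinv
    rwa [extChartAt_source] at hy
  have hτy : τ (extChartAt (𝓡 m) y y) = extChartAt (𝓡 m) x₀ y := by simp [hτ]
  have heq : γ.inChart y =ᶠ[𝓝 (extChartAt (𝓡 m) y y)]
      fun z => (γ.inChart x₀ (τ z)).comp (fderiv ℝ τ z) := by
    filter_upwards [hnear] with z hz
    ext w
    have h := γ.inChart_apply_mfderiv hz.2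
      (mfderiv 𝓘(ℝ, EuclideanSpace ℝ (Fin m)) (𝓡 m) (extChartAt (𝓡 m) y).symm z w)
    rw [← hmd z hz.1 hz.2 w] at h
    exact h.symm
  have hbase : ∀ w : TangentSpace (𝓡 m) y, fderiv ℝ τ (extChartAt (𝓡 m) y y)
      (mfderiv (𝓡 m) 𝓘(ℝ, EuclideanSpace ℝ (Fin m)) (extChartAt (𝓡 m) y) y w) =
      mfderiv (𝓡 m) 𝓘(ℝ, EuclideanSpace ℝ (Fin m)) (extChartAt (𝓡 m) x₀) y w := by
    intro w
    refine (hmd _ (mem_extChartAt_target y) (by rwa [hinv]) _).trans ?_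
    refine (congrArg _ (mfderiv_symm_mfderiv_extChartAt hyy w)).trans ?_
    rw [hinv]
  rw [← hτy] at hγ
  have key := fderiv_pullback_antisymm hτsmooth hγ
    (mfderiv (𝓡 m) 𝓘(ℝ, EuclideanSpace ℝ (Fin m)) (extChartAt (𝓡 m) y) y u)
    (mfderiv (𝓡 m) 𝓘(ℝ, EuclideanSpace ℝ (Fin m)) (extChartAt (𝓡 m) y) y v)
  rw [← heq.fderiv_eq] at key
  refine key.trans ?_
  erw [hbase u, hbase v]
  rw [hτy]

end ExteriorDerivative

/-! ### Linear algebra of independent functionals and 2-forms -/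

section LinearAlgebra

theorem eq_sum_single {ι : Type*} [Fintype ι] [DecidableEq ι] (c : ι → ℝ) :
    c = ∑ i, c i • Pi.single i 1 := by
  ext j
  simp [Finset.sum_apply, Pi.single_apply]

/-- Linearly independent functionals are the components of a surjective map. -/
theorem exists_forall_apply_eq_of_linearIndependent {V ι : Type*} [AddCommGroup V] [Module ℝ V]
    [TopologicalSpace V] [IsTopologicalAddGroup V] [ContinuousSMul ℝ V] [Fintype ι]
    {θ : ι → V →L[ℝ] ℝ} (hθ : LinearIndependent ℝ θ) (c : ι → ℝ) : ∃ v, ∀ i, θ i v = c i := by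
  classical
  let T : V →ₗ[ℝ] ι → ℝ := LinearMap.pi fun i => (θ i : V →ₗ[ℝ] ℝ)
  suffices h : LinearMap.range T = ⊤ by
    obtain ⟨v, hv⟩ := LinearMap.range_eq_top.1 h c
    exact ⟨v, fun i => congrFun hv i⟩
  by_contra h
  -- A proper range lies in the kernel of some `f ≠ 0`, whose coefficients would be a linear
  -- relation among the `θ i`.
  obtain ⟨f, hf, hle⟩ := Submodule.exists_le_ker_of_lt_top _ (lt_top_iff_ne_top.2 h)
  apply hf
  have hsum : ∀ c : ι → ℝ, f c = ∑ i, f (Pi.single i 1) * c i := by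
    intro c
    conv_lhs => rw [eq_sum_single c]
    simp [mul_comm]
  have hzero := Fintype.linearIndependent_iff.1 hθ (fun i => f (Pi.single i 1)) (by
    ext v
    have := hle ⟨v, rfl⟩
    rw [LinearMap.mem_ker, hsum] at this
    simpa [T] using this)
  ext c
  simp [hzero]

/-- A 2-form vanishing on the kernel of `T` is a sum of wedge products with the components
of `T`. -/
theorem eq_sum_wedge_of_vanish_on_ker {E : Type*} [NormedAddCommGroup E] [NormedSpace ℝ E] {k : ℕ}
    {Ω : E →L[ℝ] E →L[ℝ] ℝ} (hΩ : ∀ u v, Ω u v = -Ω v u) {T : E →L[ℝ] Fin k → ℝ}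
    {R : (Fin k → ℝ) →L[ℝ] E} (hR : ∀ c, T (R c) = c)
    (hker : ∀ u v, T u = 0 → T v = 0 → Ω u v = 0) (u v : E) :
    Ω u v = ∑ s, ((Ω u (R (Pi.single s 1)) - 1 / 2 * Ω (R (T u)) (R (Pi.single s 1))) * T v s -
      (Ω v (R (Pi.single s 1)) - 1 / 2 * Ω (R (T v)) (R (Pi.single s 1))) * T u s) := by
  have hsum : ∀ (w : E) (c : Fin k → ℝ), ∑ s, Ω w (R (Pi.single s 1)) * c s = Ω w (R c) := by
    intro w c
    conv_rhs => rw [eq_sum_single c]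
    simp [mul_comm]
  -- Expanding this zero gives `Ω u v = Ω u (R (T v)) + Ω (R (T u)) v - Ω (R (T u)) (R (T v))`. The
  -- factor `1 / 2` shares the last term equally between the two halves of the wedge.
  have h := hker (u - R (T u)) (v - R (T v)) (by simp [hR]) (by simp [hR])
  simp only [map_sub, sub_apply] at h
  simp only [sub_mul, Finset.sum_sub_distrib, mul_assoc, ← Finset.mul_sum, hsum]
  rw [hΩ v (R (T u)), hΩ (R (T v)) (R (T u))]
  linarith

end LinearAlgebra

/-! ### Analytic right inverses and differentiation along a kernel -/

section RightInverse

open Filter Topology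

variable {E F : Type*} [NormedAddCommGroup E] [NormedSpace ℝ E] [NormedAddCommGroup F]
  [NormedSpace ℝ F]

/-- The right inverse of `T` with the same range as `S`, if `T ∘ S` is invertible. -/
noncomputable def rightInverse (S : F →L[ℝ] E) (T : E →L[ℝ] F) : F →L[ℝ] E :=
  S.comp (Ring.inverse (T.comp S))

theorem apply_rightInverse {S : F →L[ℝ] E} {T : E →L[ℝ] F} (h : IsUnit (T.comp S)) (c : F) :
    T (rightInverse S T c) = c := by
  have := Ring.mul_inverse_cancel _ h
  exact DFunLike.congr_fun this c

theorem contDiffAt_rightInverse [CompleteSpace F] {S : F →L[ℝ] E} {T : E → E →L[ℝ] F} {z : E}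
    (hT : ContDiffAt ℝ ω T z) (h : IsUnit ((T z).comp S)) :
    ContDiffAt ℝ ω (fun z => rightInverse S (T z)) z := by
  have h1 : ContDiffAt ℝ ω (fun z => (T z).comp S) z := hT.clm_comp contDiffAt_const
  have h2 : ContDiffAt ℝ ω Ring.inverse ((T z).comp S) := by
    obtain ⟨a, ha⟩ := h
    rw [← ha]
    exact contDiffAt_ringInverse ℝ a
  have h3 : ContDiffAt ℝ ω (fun z => Ring.inverse ((T z).comp S)) z :=
    ContDiffAt.comp (g := Ring.inverse) (f := fun z => (T z).comp S) z h2 h1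
  exact contDiffAt_const.clm_comp h3

theorem eventually_isUnit_comp [CompleteSpace F] {S : F →L[ℝ] E} {T : E → E →L[ℝ] F} {z : E}
    (hT : ContinuousAt T z) (h : IsUnit ((T z).comp S)) :
    ∀ᶠ y in 𝓝 z, IsUnit ((T y).comp S) := by
  have h1 : ContinuousAt (fun z => (T z).comp S) z := hT.clm_comp continuousAt_const
  exact h1.eventually_mem (Units.isOpen.mem_nhds h)

theorem contDiffAt_flip {G : Type*} [NormedAddCommGroup G] [NormedSpace ℝ G]
    {B : E → F →L[ℝ] F →L[ℝ] G} {z : E} (hB : ContDiffAt ℝ ω B z) :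
    ContDiffAt ℝ ω (fun z => (B z).flip) z := by
  let L : (F →L[ℝ] F →L[ℝ] G) →L[ℝ] F →L[ℝ] F →L[ℝ] G :=
    (ContinuousLinearMap.flipₗᵢ ℝ F F G).toContinuousLinearEquiv.toContinuousLinearMap
  exact (ContinuousLinearMap.contDiff (E := F →L[ℝ] F →L[ℝ] G) (F := F →L[ℝ] F →L[ℝ] G)
    L).contDiffAt.comp z hB

/-- If a covector field `h` vanishes on the kernel of `T` and at `z`, so does its derivative
at `z`. -/
theorem fderiv_apply_eq_zero_of_vanish_on_ker [CompleteSpace F] {S : F →L[ℝ] E}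
    {T : E → E →L[ℝ] F} {z : E} (hT : ContDiffAt ℝ ω T z) (hS : IsUnit ((T z).comp S))
    {h : E → E →L[ℝ] ℝ} (hh : DifferentiableAt ℝ h z) (hz : h z = 0)
    (hker : ∀ᶠ y in 𝓝 z, ∀ v, T y v = 0 → h y v = 0) (u : E) {v : E} (hv : T z v = 0) :
    fderiv ℝ h z u v = 0 := by
  -- `V` extends `v` to a field tangent to `ker T` near `z`. Differentiating `h (V) = 0` at `z`
  -- leaves only the derivative of `h`, because `h z = 0`.
  set V : E → E := fun y => v - rightInverse S (T y) (T y v) with hV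
  have hVd : DifferentiableAt ℝ V z := by
    have hR := (contDiffAt_rightInverse hT hS).differentiableAt (by simp)
    have hTd := hT.differentiableAt (by simp)
    exact (differentiableAt_const v).sub (hR.clm_apply (hTd.clm_apply (differentiableAt_const v)))
  have hzero : (fun y => h y (V y)) =ᶠ[𝓝 z] fun _ => 0 := by
    filter_upwards [hker, eventually_isUnit_comp hT.continuousAt hS] with y hy hu
    exact hy _ (by simp [hV, apply_rightInverse hu])
  have h1 := (hh.hasFDerivAt.clm_apply hVd.hasFDerivAt).fderiv
  rw [hzero.fderiv_eq] at h1
  have h2 := DFunLike.congr_fun h1 u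
  simpa [hz, hV, hv] using h2.symm

end RightInverse

/-! ### Frobenius criterion: integrability as vanishing of exterior derivatives -/

section Integrability

open Set Filter Topology

variable {m : ℕ} {M : Type*} [TopologicalSpace M] [ChartedSpace (EuclideanSpace ℝ (Fin m)) M]

/-- The local expression of a family of 1-forms, as a map to `ℝᵏ`. -/
noncomputable def frameInChart {k : ℕ} (θ : Fin k → OneForm m M) (x₀ : M)
    (z : EuclideanSpace ℝ (Fin m)) : EuclideanSpace ℝ (Fin m) →L[ℝ] Fin k → ℝ :=
  ContinuousLinearMap.pi fun i => (θ i).inChart x₀ z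

variable [IsManifold (𝓡 m) ω M] {k : ℕ} {D : (x : M) → Submodule ℝ (TangentSpace (𝓡 m) x)}
  {θ : Fin k → OneForm m M} {U : Set M}

theorem IsAnnihilatingFrameOn.mono {V : Set M} (h : IsAnnihilatingFrameOn D θ U) (hV : V ⊆ U) :
    IsAnnihilatingFrameOn D θ V :=
  ⟨fun i => ContMDiffOn.mono (h.analyticOn i) hV, fun x hx => h.linearIndependent x (hV hx),
    fun x hx => h.mem_iff x (hV hx)⟩

theorem IsAnnihilatingFrameOn.contDiffAt_frameInChart (h : IsAnnihilatingFrameOn D θ U)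
    (hU : IsOpen U) {x₀ p : M} (hp : p ∈ U)
    (hps : p ∈ (chartAt (EuclideanSpace ℝ (Fin m)) x₀).source) :
    ContDiffAt ℝ ω (frameInChart θ x₀) (extChartAt (𝓡 m) x₀ p) := by
  have h1 : frameInChart θ x₀ = fun z => ∑ i,
      (ContinuousLinearMap.single ℝ (fun _ : Fin k => ℝ) i).comp ((θ i).inChart x₀ z) := by
    ext z v j
    simp [frameInChart, Finset.sum_apply, Pi.single_apply]
  rw [h1]
  exact ContDiffAt.sum fun i _ =>
    contDiffAt_const.clm_comp ((h.analyticOn i).contDiffAt_inChart hU hp hps)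

theorem frameInChart_mfderiv (θ : Fin k → OneForm m M) {x₀ p : M}
    (hp : p ∈ (extChartAt (𝓡 m) x₀).source) (v : TangentSpace (𝓡 m) p) :
    frameInChart θ x₀ (extChartAt (𝓡 m) x₀ p)
      (mfderiv (𝓡 m) 𝓘(ℝ, EuclideanSpace ℝ (Fin m)) (extChartAt (𝓡 m) x₀) p v) =
      fun i => θ i p v :=
  funext fun i => (θ i).inChart_apply_mfderiv hp v

/-- The fixed `S` is chosen at one point; invertibility of `T ∘ S` is an open condition, so it
yields analytic right inverses nearby. -/
theorem IsAnnihilatingFrameOn.exists_rightInverse (h : IsAnnihilatingFrameOn D θ U) {x₀ p : M}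
    (hp : p ∈ U) (hps : p ∈ (extChartAt (𝓡 m) x₀).source) :
    ∃ S : (Fin k → ℝ) →L[ℝ] EuclideanSpace ℝ (Fin m),
      IsUnit ((frameInChart θ x₀ (extChartAt (𝓡 m) x₀ p)).comp S) := by
  have hsurj : Function.Surjective (frameInChart θ x₀ (extChartAt (𝓡 m) x₀ p)) := by
    intro c
    obtain ⟨v, hv⟩ := exists_forall_apply_eq_of_linearIndependent (h.linearIndependent p hp) c
    exact ⟨_, (frameInChart_mfderiv θ hps v).trans (funext hv)⟩
  obtain ⟨S, hS⟩ := LinearMap.exists_rightInverse_of_surjective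
    (frameInChart θ x₀ (extChartAt (𝓡 m) x₀ p) : EuclideanSpace ℝ (Fin m) →ₗ[ℝ] Fin k → ℝ)
    (LinearMap.range_eq_top.2 hsurj)
  refine ⟨LinearMap.toContinuousLinearMap S, ?_⟩
  have : (frameInChart θ x₀ (extChartAt (𝓡 m) x₀ p)).comp (LinearMap.toContinuousLinearMap S) =
      1 := by
    ext1 c
    exact DFunLike.congr_fun hS c
  rw [this]
  exact isUnit_one

/-- The exterior derivative of a 1-form vanishing on an integrable distribution vanishes there. -/
theorem TangentDistribution.IsIntegrable.d_eq_zero {D : TangentDistribution m M k}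
    (hD : D.IsIntegrable) {γ : OneForm m M} (hU : IsOpen U) (hγ : γ.AnalyticOn U)
    (hvan : ∀ y ∈ U, ∀ v ∈ D.fiber y, γ y v = 0) {y : M} (hy : y ∈ U)
    {u v : TangentSpace (𝓡 m) y} (hu : u ∈ D.fiber y) (hv : v ∈ D.fiber y) :
    γ.d y u v = 0 := by
  obtain ⟨V, hV, hyV, θ, hθ, β, -, hβ⟩ := hD y
  have hys : y ∈ (extChartAt (𝓡 m) y).source := mem_extChartAt_source y
  have hys' := mem_chart_source (EuclideanSpace ℝ (Fin m)) y
  obtain ⟨S, hS⟩ := hθ.exists_rightInverse hyV hys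
  set z := extChartAt (𝓡 m) y y with hz
  set T := frameInChart θ y with hTdef
  have hT : ContDiffAt ℝ ω T z := hθ.contDiffAt_frameInChart hV hyV hys'
  have hg : DifferentiableAt ℝ (γ.inChart y) z :=
    (hγ.contDiffAt_inChart hU hy hys').differentiableAt (by simp)
  have hTd : DifferentiableAt ℝ T z := hT.differentiableAt (by simp)
  have hker : ∀ᶠ z' in 𝓝 z, ∀ v, T z' v = 0 → γ.inChart y z' v = 0 := by
    have h1 : ∀ᶠ z' in 𝓝 z, (extChartAt (𝓡 m) y).symm z' ∈ U ∩ V := by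
      apply (continuousAt_extChartAt_symm y).eventually_mem
      rw [(extChartAt (𝓡 m) y).left_inv hys]
      exact (hU.inter hV).mem_nhds ⟨hy, hyV⟩
    filter_upwards [h1] with z' hz' v hv
    exact hvan _ hz'.1 _ ((hθ.mem_iff _ hz'.2 _).2 fun i => congrFun hv i)
  -- The coefficients expressing `γ` through the `θ i` are frozen at `z`. Then `γ - f ∘ T` vanishes
  -- at `z` and on nearby kernels, so on the kernel at `z` the form `dγ` equals `f` applied to the
  -- `dθ i`; no derivative of coefficients is needed.
  set f : (Fin k → ℝ) →L[ℝ] ℝ := (γ.inChart y z).comp (rightInverse S (T z)) with hf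
  have hfT : HasFDerivAt (fun z' => f.comp (T z'))
      ((ContinuousLinearMap.compL ℝ _ _ _ f).comp (fderiv ℝ T z)) z :=
    (ContinuousLinearMap.compL ℝ (EuclideanSpace ℝ (Fin m)) _ _ f).hasFDerivAt.comp z
      hTd.hasFDerivAt
  have hfd : HasFDerivAt (fun z' => γ.inChart y z' - f.comp (T z'))
      (fderiv ℝ (γ.inChart y) z -
        (ContinuousLinearMap.compL ℝ _ _ _ f).comp (fderiv ℝ T z)) z :=
    hg.hasFDerivAt.sub hfT
  have hbase : γ.inChart y z - f.comp (T z) = 0 := by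
    ext w
    have := hker.self_of_nhds (w - rightInverse S (T z) (T z w))
      (by simp [apply_rightInverse hS])
    simpa [hf] using this
  have key : ∀ a b, T z b = 0 →
      fderiv ℝ (γ.inChart y) z a b = f (fderiv ℝ T z a b) := by
    intro a b hb
    have := fderiv_apply_eq_zero_of_vanish_on_ker hT hS hfd.differentiableAt hbase
      (by filter_upwards [hker] with z' hz' v hv; simp [hz' v hv, hv]) a hb
    rw [hfd.fderiv] at this
    simpa [sub_eq_zero] using this
  have hTu := frameInChart_mfderiv θ hys u
  have hTv := frameInChart_mfderiv θ hys v
  rw [show (fun i => θ i y u) = 0 from funext ((hθ.mem_iff y hyV u).1 hu)] at hTu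
  rw [show (fun i => θ i y v) = 0 from funext ((hθ.mem_iff y hyV v).1 hv)] at hTv
  have hcomp : ∀ i a b, fderiv ℝ T z a b i = fderiv ℝ ((θ i).inChart y) z a b := by
    intro i a b
    have h1 : HasFDerivAt (fun z' => (θ i).inChart y z')
        ((ContinuousLinearMap.compL ℝ (EuclideanSpace ℝ (Fin m)) _ _
          (ContinuousLinearMap.proj (R := ℝ) (φ := fun _ : Fin k => ℝ) i)).comp
          (fderiv ℝ T z)) z :=
      (ContinuousLinearMap.compL ℝ (EuclideanSpace ℝ (Fin m)) _ _
        (ContinuousLinearMap.proj (R := ℝ) (φ := fun _ : Fin k => ℝ) i)).hasFDerivAt.comp z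
        hTd.hasFDerivAt
    rw [h1.fderiv]
    rfl
  have hd : ∀ i, (θ i).d y u v = 0 := by
    intro i
    rw [hβ y hyV i u v]
    refine Finset.sum_eq_zero fun s _ => ?_
    simp [OneForm.wedge, (hθ.mem_iff y hyV u).1 hu s, (hθ.mem_iff y hyV v).1 hv s]
  have hlocal : ∀ a b, T z a = 0 → T z b = 0 →
      (∀ i, fderiv ℝ ((θ i).inChart y) z a b - fderiv ℝ ((θ i).inChart y) z b a = 0) →
      fderiv ℝ (γ.inChart y) z a b - fderiv ℝ (γ.inChart y) z b a = 0 := by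
    intro a b ha hb hab
    rw [key _ _ hb, key _ _ ha, ← map_sub]
    have : fderiv ℝ T z a b - fderiv ℝ T z b a = 0 := by
      ext i
      rw [Pi.sub_apply, hcomp, hcomp]
      exact hab i
    rw [this, map_zero]
  exact hlocal _ _ hTu hTv hd

/-- A distribution is integrable if the exterior derivatives of local forms defining it
vanish on it. -/
theorem TangentDistribution.isIntegrable_of_d_eq_zero {D : TangentDistribution m M k}
    (h : ∀ x : M, ∃ U : Set M, IsOpen U ∧ x ∈ U ∧ ∃ θ : Fin k → OneForm m M,
      IsAnnihilatingFrameOn D.fiber θ U ∧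
        ∀ y ∈ U, ∀ i, ∀ u ∈ D.fiber y, ∀ v ∈ D.fiber y, (θ i).d y u v = 0) :
    D.IsIntegrable := by
  intro x
  obtain ⟨U, hU, hxU, θ, hθ, hd⟩ := h x
  have hxs : x ∈ (extChartAt (𝓡 m) x).source := mem_extChartAt_source x
  have hxs' := mem_chart_source (EuclideanSpace ℝ (Fin m)) x
  obtain ⟨S, hS⟩ := hθ.exists_rightInverse hxU hxs
  set T := frameInChart θ x with hTdef
  have hnear : ∀ᶠ p in 𝓝 x, IsUnit ((T (extChartAt (𝓡 m) x p)).comp S) :=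
    (continuousAt_extChartAt x).eventually
      (eventually_isUnit_comp (hθ.contDiffAt_frameInChart hU hxU hxs').continuousAt hS)
  obtain ⟨W, hWsub, hW, hxW⟩ := mem_nhds_iff.1
    (inter_mem hnear (inter_mem (hU.mem_nhds hxU) ((chartAt _ x).open_source.mem_nhds hxs')))
  have hWU : W ⊆ U := fun p hp => (hWsub hp).2.1
  have hWs : W ⊆ (chartAt (EuclideanSpace ℝ (Fin m)) x).source := fun p hp => (hWsub hp).2.2
  have hTs : ∀ p ∈ W, ContDiffAt ℝ ω T (extChartAt (𝓡 m) x p) := fun p hp =>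
    hθ.contDiffAt_frameInChart hU (hWU hp) (hWs hp)
  have hgs : ∀ p ∈ W, ∀ i, ContDiffAt ℝ ω ((θ i).inChart x) (extChartAt (𝓡 m) x p) :=
    fun p hp i => (hθ.analyticOn i).contDiffAt_inChart hU (hWU hp) (hWs hp)
  let R z := rightInverse S (T z)
  let Ω i z := fderiv ℝ ((θ i).inChart x) z - (fderiv ℝ ((θ i).inChart x) z).flip
  -- These are the coefficients of `eq_sum_wedge_of_vanish_on_ker`, rewritten by antisymmetry with
  -- the variable in the last slot, so that analyticity follows from composition.
  let b (i s : Fin k) z : EuclideanSpace ℝ (Fin m) →L[ℝ] ℝ :=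
    (1 / 2 : ℝ) • (Ω i z (R z (Pi.single s 1))).comp ((R z).comp (T z)) -
      Ω i z (R z (Pi.single s 1))
  have hΩ : ∀ i z u v, Ω i z u v = -Ω i z v u := by
    intro i z u v
    simp [Ω]
  refine ⟨W, hW, hxW, θ, hθ.mono hWU, fun i s => OneForm.ofChart x (b i s), fun i s => ?_,
    fun p hp i u v => ?_⟩
  · refine OneForm.analyticOn_ofChart x hWs fun p hp => ?_
    have hR : ContDiffAt ℝ ω R (extChartAt (𝓡 m) x p) :=
      contDiffAt_rightInverse (hTs p hp) (hWsub hp).1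
    have hDg : ContDiffAt ℝ ω (fderiv ℝ ((θ i).inChart x)) (extChartAt (𝓡 m) x p) :=
      (hgs p hp i).fderiv_right (by simp)
    have hflip : ContDiffAt ℝ ω (fun z => (fderiv ℝ ((θ i).inChart x) z).flip)
        (extChartAt (𝓡 m) x p) :=
      contDiffAt_flip hDg
    have hΩs : ContDiffAt ℝ ω (Ω i) (extChartAt (𝓡 m) x p) := hDg.sub hflip
    have h1 : ContDiffAt ℝ ω (fun z => Ω i z (R z (Pi.single s 1))) (extChartAt (𝓡 m) x p) :=
      hΩs.clm_apply (hR.clm_apply contDiffAt_const)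
    exact ((h1.clm_comp (hR.clm_comp (hTs p hp))).const_smul _).sub h1
  · have hps : p ∈ (extChartAt (𝓡 m) x).source := by
      rw [extChartAt_source]
      exact hWs hp
    have hsurj : Function.Surjective
        (mfderiv (𝓡 m) 𝓘(ℝ, EuclideanSpace ℝ (Fin m)) (extChartAt (𝓡 m) x) p) :=
      (isInvertible_mfderiv_extChartAt hps).bijective.2
    have hd' := fun u v => OneForm.d_eq_of_mem_source (γ := θ i) hps
      ((hgs p hp i).differentiableAt (by simp)) u v
    have hker : ∀ u' v', T (extChartAt (𝓡 m) x p) u' = 0 → T (extChartAt (𝓡 m) x p) v' = 0 →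
        Ω i (extChartAt (𝓡 m) x p) u' v' = 0 := by
      intro u' v' hu' hv'
      obtain ⟨u, rfl⟩ := hsurj u'
      obtain ⟨v, rfl⟩ := hsurj v'
      have h1 := (frameInChart_mfderiv θ hps u).symm.trans hu'
      have h2 := (frameInChart_mfderiv θ hps v).symm.trans hv'
      exact (hd' u v).symm.trans (hd p (hWU hp) i u
        ((hθ.mem_iff p (hWU hp) u).2 (congrFun h1)) v
        ((hθ.mem_iff p (hWU hp) v).2 (congrFun h2)))
    have key := eq_sum_wedge_of_vanish_on_ker (hΩ i (extChartAt (𝓡 m) x p))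
      (R := R (extChartAt (𝓡 m) x p)) (apply_rightInverse (hWsub hp).1) hker
      (mfderiv (𝓡 m) 𝓘(ℝ, EuclideanSpace ℝ (Fin m)) (extChartAt (𝓡 m) x) p u)
      (mfderiv (𝓡 m) 𝓘(ℝ, EuclideanSpace ℝ (Fin m)) (extChartAt (𝓡 m) x) p v)
    refine (hd' u v).trans (key.trans (Finset.sum_congr rfl fun s _ => ?_))
    have hb : ∀ w, b i s (extChartAt (𝓡 m) x p) w =
        Ω i (extChartAt (𝓡 m) x p) w (R (extChartAt (𝓡 m) x p) (Pi.single s 1)) -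
        1 / 2 * Ω i (extChartAt (𝓡 m) x p)
          (R (extChartAt (𝓡 m) x p) (T (extChartAt (𝓡 m) x p) w))
          (R (extChartAt (𝓡 m) x p) (Pi.single s 1)) := by
      intro w
      rw [hΩ i _ w, hΩ i _ (R _ (T _ _))]
      simp only [b, sub_apply, smul_apply, ContinuousLinearMap.comp_apply, smul_eq_mul]
      ring
    have hTw := fun w => congrFun (frameInChart_mfderiv θ hps w) s
    have hbs := congrArg₂ (· - ·)
      (congrArg₂ (· * ·) (hb (mfderiv (𝓡 m) 𝓘(ℝ, EuclideanSpace ℝ (Fin m))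
        (extChartAt (𝓡 m) x) p u)).symm (hTw v))
      (congrArg₂ (· * ·) (hb (mfderiv (𝓡 m) 𝓘(ℝ, EuclideanSpace ℝ (Fin m))
        (extChartAt (𝓡 m) x) p v)).symm (hTw u))
    exact hbs

end Integrability

/-! ### Binary forms and the rational normal curve -/

section BinaryForms

open Polynomial

/-- The numerator of the homogeneous coordinates of a point of the projective line. -/
noncomputable def num : OnePoint ℝ → ℝ
  | none => 1
  | some s => s

/-- The denominator of the homogeneous coordinates of a point of the projective line. -/
noncomputable def den : OnePoint ℝ → ℝ
  | none => 0
  | some _ => 1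

/-- The point of the rational normal curve of degree `n` with parameter `t`. -/
noncomputable def veroneseCoeff (n : ℕ) : OnePoint ℝ → Fin (n + 1) → ℝ
  | none => Pi.single (Fin.last n) 1
  | some s => fun j => s ^ (j : ℕ)

/-- A polynomial of degree at most `N` which, as a binary form of degree `N`, vanishes at `N + 1`
points of the projective line, is zero. -/
theorem polynomial_eq_zero_of_projective_roots {N : ℕ} {P : ℝ[X]} (hP : P.natDegree ≤ N)
    {a : Fin (N + 1) → OnePoint ℝ} (ha : Function.Injective a)
    (hinf : ∀ j, a j = none → P.coeff N = 0) (hroot : ∀ j s, a j = some s → P.eval s = 0) :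
    P = 0 := by
  have hdeg : P.degree ≤ N := natDegree_le_iff_degree_le.1 hP
  have hnum : ∀ j, a j ≠ none → a j = some (num (a j)) := by
    intro j hj
    rcases h : a j with _ | s
    · exact absurd h hj
    · rfl
  have hinj : ∀ S : Finset (Fin (N + 1)), (∀ j ∈ S, a j ≠ none) →
      Set.InjOn (fun j => num (a j)) S := by
    intro S hS i hi j hj hij
    apply ha
    rw [hnum i (hS i hi), hnum j (hS j hj)]
    exact congrArg some hij
  by_cases h : ∃ j₀, a j₀ = none
  · obtain ⟨j₀, hj₀⟩ := h
    have hne : ∀ j ∈ Finset.univ.erase j₀, a j ≠ none := fun j hj hj' =>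
      Finset.ne_of_mem_erase hj (ha (hj'.trans hj₀.symm))
    refine eq_zero_of_degree_lt_of_eval_index_eq_zero _ (hinj _ hne) ?_
      fun j hj => hroot j _ (hnum j (hne j hj))
    -- A root at infinity kills the coefficient of degree `N`, so the remaining `N` finite roots
    -- suffice.
    rw [Finset.card_erase_of_mem (Finset.mem_univ _), Finset.card_fin, Nat.add_sub_cancel]
    refine lt_of_le_of_ne hdeg fun h => ?_
    exact coeff_ne_zero_of_eq_degree h (hinf j₀ hj₀)
  · push Not at h
    refine eq_zero_of_degree_lt_of_eval_index_eq_zero _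
      (hinj Finset.univ fun j _ => h j) ?_ fun j _ => hroot j _ (hnum j (h j))
    rw [Finset.card_fin]
    exact lt_of_le_of_lt hdeg (by exact_mod_cast Nat.lt_succ_self N)

/-- `Fin.cons 0 e` and `Fin.snoc e 0` are the coefficient vectors of `x * e(x)` and `e(x)`, and `den
t * x - num t` vanishes at `t`. -/
theorem sum_veroneseCoeff_mul_eq_zero {n : ℕ} (t : OnePoint ℝ) (e : Fin n → ℝ) :
    ∑ j, veroneseCoeff n t j * (den t * (Fin.cons 0 e : Fin (n + 1) → ℝ) j -
      num t * (Fin.snoc e 0 : Fin (n + 1) → ℝ) j) = 0 := by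
  rcases t with _ | s
  · simp [veroneseCoeff, num, den, Pi.single_apply]
  · simp only [veroneseCoeff, num, den, one_mul, mul_sub, Finset.sum_sub_distrib]
    rw [Fin.sum_univ_succ, Fin.sum_univ_castSucc (n := n)]
    simp only [Fin.cons_zero, Fin.cons_succ, Fin.snoc_castSucc, Fin.snoc_last, Fin.val_succ,
      Fin.val_castSucc, mul_zero, zero_add, add_zero, pow_succ, mul_assoc, sub_self]

/-- The hyperplane orthogonal to a point of the rational normal curve of degree `n` is
parametrized linearly in the homogeneous coordinates of the point. -/
theorem exists_cons_sub_snoc {n : ℕ} (t : OnePoint ℝ) (c : Fin (n + 1) → ℝ)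
    (hc : ∑ j, veroneseCoeff n t j * c j = 0) :
    ∃ e : Fin n → ℝ, ∀ j, c j = den t * (Fin.cons 0 e : Fin (n + 1) → ℝ) j -
      num t * (Fin.snoc e 0 : Fin (n + 1) → ℝ) j := by
  rcases t with _ | s
  · refine ⟨fun j => -c j.castSucc, fun j => ?_⟩
    have hlast : c (Fin.last n) = 0 := by simpa [veroneseCoeff, Pi.single_apply] using hc
    refine Fin.lastCases ?_ (fun j => ?_) j <;> simp [num, den, hlast]
  · let c' : ℕ → ℝ := fun l => if h : l < n + 1 then c ⟨l, h⟩ else 0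
    -- Synthetic division by `x - s`: `H (l + 1)` is the coefficient of `x ^ l` in the quotient, and
    -- `H 0` is the remainder `c(s) = 0`.
    let H : ℕ → ℝ := fun l => ∑ r ∈ Finset.range (n + 1 - l), s ^ r * c' (l + r)
    have hrec : ∀ l, l ≤ n → H l = c' l + s * H (l + 1) := by
      intro l hl
      simp only [H]
      rw [show n + 1 - l = (n + 1 - (l + 1)) + 1 by omega, Finset.sum_range_succ', Finset.mul_sum,
        add_comm]
      congr 1
      · simp
      · refine Finset.sum_congr rfl fun r _ => ?_
        rw [show l + (r + 1) = l + 1 + r by omega]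
        ring
    have hH0 : H 0 = 0 := by
      simp only [H, Nat.sub_zero, zero_add, Finset.sum_range]
      rw [← hc]
      refine Finset.sum_congr rfl fun j _ => ?_
      simp [c', veroneseCoeff, j.is_le]
    have hHn : H (n + 1) = 0 := by simp [H]
    refine ⟨fun j => H (j + 1), fun j => ?_⟩
    have h1 : (Fin.cons 0 (fun j : Fin n => H (j + 1)) : Fin (n + 1) → ℝ) j = H j := by
      refine Fin.cases ?_ (fun j => ?_) j <;> simp [hH0]
    have h2 : (Fin.snoc (fun j : Fin n => H (j + 1)) 0 : Fin (n + 1) → ℝ) j = H (j + 1) := by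
      refine Fin.lastCases ?_ (fun j => ?_) j <;> simp [hHn]
    rw [h1, h2, hrec j (by omega)]
    simp [num, den, c', j.is_le]

/-- If bilinear forms `Ω(t)` depending on `t` through the rational normal curve of degree `n` vanish
on vectors `den t • A - num t • B` for `n + 3` values of `t`, then they do so for all `t`. -/
theorem sum_veroneseCoeff_bilin_eq_zero {n : ℕ} {V : Type*} [AddCommGroup V] [Module ℝ V]
    (Ω : Fin (n + 1) → V →ₗ[ℝ] V →ₗ[ℝ] ℝ) (A B A' B' : V) {a : Fin (n + 3) → OnePoint ℝ}
    (ha : Function.Injective a)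
    (h : ∀ r, ∑ j, veroneseCoeff n (a r) j * Ω j (den (a r) • A - num (a r) • B)
      (den (a r) • A' - num (a r) • B') = 0) (t : OnePoint ℝ) :
    ∑ j, veroneseCoeff n t j * Ω j (den t • A - num t • B) (den t • A' - num t • B') = 0 := by
  let P : ℝ[X] := ∑ j : Fin (n + 1), (C (Ω j A A') * X ^ (j : ℕ) -
    C (Ω j A B' + Ω j B A') * X ^ ((j : ℕ) + 1) + C (Ω j B B') * X ^ ((j : ℕ) + 2))
  have hdeg : P.natDegree ≤ n + 2 := by
    refine natDegree_sum_le_of_forall_le _ _ fun j _ => ?_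
    have hmono : ∀ (c : ℝ) (p : ℕ), p ≤ n + 2 → (C c * X ^ p : ℝ[X]).natDegree ≤ n + 2 :=
      fun c p hp => (natDegree_C_mul_X_pow_le c p).trans hp
    exact (natDegree_add_le _ _).trans (max_le ((natDegree_sub_le _ _).trans
      (max_le (hmono _ _ (by omega)) (hmono _ _ (by omega)))) (hmono _ _ (by omega)))
  have heval : ∀ s : ℝ, P.eval s = ∑ j, veroneseCoeff n (some s) j *
      Ω j (den (some s) • A - num (some s) • B) (den (some s) • A' - num (some s) • B') := by
    intro s
    simp only [P, eval_finsetSum]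
    refine Finset.sum_congr rfl fun j _ => ?_
    simp [veroneseCoeff, num, den]
    ring
  -- The value of the binary form at infinity is its top coefficient, to which only `j = n`
  -- contributes.
  have hcoeff : P.coeff (n + 2) = ∑ j, veroneseCoeff n none j *
      Ω j (den none • A - num none • B) (den none • A' - num none • B') := by
    simp only [P, finsetSum_coeff]
    refine Finset.sum_congr rfl fun j _ => ?_
    have h0 : n + 2 ≠ (j : ℕ) := by omega
    have h1 : n + 1 ≠ (j : ℕ) := by omega
    have h2 : n = (j : ℕ) ↔ j = Fin.last n := by
      rw [Fin.ext_iff, Fin.val_last, eq_comm]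
    rw [coeff_add, coeff_sub, coeff_C_mul_X_pow, coeff_C_mul_X_pow, coeff_C_mul_X_pow]
    simp [veroneseCoeff, num, den, h0, h1, h2, Pi.single_apply]
  have hzero : P = 0 := by
    refine polynomial_eq_zero_of_projective_roots hdeg ha (fun r hr => ?_) fun r s hr => ?_
    · rw [hcoeff, ← hr]
      exact h r
    · rw [heval, ← hr]
      exact h r
  rcases t with _ | s
  · exact hcoeff.symm.trans (by simp [hzero])
  · exact (heval s).symm.trans (by simp [hzero])

/-- Let `l i j` be linear coordinates on `V`. If `Ω(t) = ∑ⱼ tʲ Ωⱼ` vanishes on the common kernel of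
the functionals `∑ⱼ tʲ l i j` for `n + 3` values of `t`, then it does so for all `t`. -/
theorem bilin_vanish_on_veronese_kernel {k n : ℕ} {V : Type*} [AddCommGroup V] [Module ℝ V]
    {l : Fin k → Fin (n + 1) → V →ₗ[ℝ] ℝ}
    (hinj : ∀ v, (∀ i j, l i j v = 0) → v = 0)
    (hsurj : ∀ c : Fin k → Fin (n + 1) → ℝ, ∃ v, ∀ i j, l i j v = c i j)
    (Ω : Fin (n + 1) → V →ₗ[ℝ] V →ₗ[ℝ] ℝ) {a : Fin (n + 3) → OnePoint ℝ}
    (ha : Function.Injective a)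
    (h : ∀ r u v, (∀ i, ∑ j, veroneseCoeff n (a r) j * l i j u = 0) →
      (∀ i, ∑ j, veroneseCoeff n (a r) j * l i j v = 0) →
      ∑ j, veroneseCoeff n (a r) j * Ω j u v = 0) (t : OnePoint ℝ) (u v : V)
    (hu : ∀ i, ∑ j, veroneseCoeff n t j * l i j u = 0)
    (hv : ∀ i, ∑ j, veroneseCoeff n t j * l i j v = 0) :
    ∑ j, veroneseCoeff n t j * Ω j u v = 0 := by
  have hpar : ∀ w : V, (∀ i, ∑ j, veroneseCoeff n t j * l i j w = 0) → ∃ A B : V,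
      w = den t • A - num t • B ∧
      ∀ s i, ∑ j, veroneseCoeff n s j * l i j (den s • A - num s • B) = 0 := by
    -- The quotient `e` is computed at `t` alone; the resulting `A` and `B` then serve every `s`.
    intro w hw
    choose e he using fun i => exists_cons_sub_snoc t (fun j => l i j w) (hw i)
    obtain ⟨A, hA⟩ := hsurj fun i => Fin.cons 0 (e i)
    obtain ⟨B, hB⟩ := hsurj fun i => Fin.snoc (e i) 0
    refine ⟨A, B, ?_, fun s i => ?_⟩
    · rw [← sub_eq_zero]
      refine hinj _ fun i j => ?_
      simp [hA, hB, he i j]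
    · rw [← sum_veroneseCoeff_mul_eq_zero s (e i)]
      simp [hA, hB]
  obtain ⟨A, B, rfl, hAB⟩ := hpar u hu
  obtain ⟨A', B', rfl, hAB'⟩ := hpar v hv
  exact sum_veroneseCoeff_bilin_eq_zero Ω A B A' B' ha
    (fun r => h r _ _ (hAB (a r)) (hAB' (a r))) t

end BinaryForms

/-! ### Exterior derivative along the curve, and the theorem -/

section Main

variable {m : ℕ} {M : Type*} [TopologicalSpace M] [ChartedSpace (EuclideanSpace ℝ (Fin m)) M]

theorem veroneseForm_eq_sum {n : ℕ} (γ : Fin (n + 1) → OneForm m M) (t : OnePoint ℝ) :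
    veroneseForm γ t = fun x => ∑ j, veroneseCoeff n t j • γ j x := by
  rcases t with _ | s
  · funext x
    simp [veroneseForm, veroneseCoeff, Pi.single_apply]
  · rfl

theorem veroneseForm_apply {n : ℕ} (γ : Fin (n + 1) → OneForm m M) (t : OnePoint ℝ) (x : M)
    (v : TangentSpace (𝓡 m) x) :
    veroneseForm γ t x v = ∑ j, veroneseCoeff n t j * γ j x v := by
  rw [veroneseForm_eq_sum]
  simp

/-- The antisymmetrization of a bilinear map. -/
noncomputable def antisymmetrization {E : Type*} [NormedAddCommGroup E] [NormedSpace ℝ E]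
    (A : E →L[ℝ] E →L[ℝ] ℝ) : E →ₗ[ℝ] E →ₗ[ℝ] ℝ :=
  LinearMap.mk₂ ℝ (fun u v => A u v - A v u)
    (fun u u' v => by simp; ring) (fun c u v => by simp; ring)
    (fun u v v' => by simp; ring) (fun c u v => by simp; ring)

/-- The exterior derivative at a point, as a bilinear map. -/
noncomputable def OneForm.dBilin (γ : OneForm m M) (x : M) :
    TangentSpace (𝓡 m) x →ₗ[ℝ] TangentSpace (𝓡 m) x →ₗ[ℝ] ℝ :=
  let L : TangentSpace (𝓡 m) x →L[ℝ] EuclideanSpace ℝ (Fin m) :=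
    mfderiv (𝓡 m) 𝓘(ℝ, EuclideanSpace ℝ (Fin m)) (extChartAt (𝓡 m) x) x
  (antisymmetrization (fderiv ℝ (γ.inChart x) (extChartAt (𝓡 m) x x))).compl₁₂
    (L : TangentSpace (𝓡 m) x →ₗ[ℝ] EuclideanSpace ℝ (Fin m))
    (L : TangentSpace (𝓡 m) x →ₗ[ℝ] EuclideanSpace ℝ (Fin m))

theorem OneForm.d_veroneseForm {n : ℕ} {γ : Fin (n + 1) → OneForm m M} {x : M}
    (hγ : ∀ j, DifferentiableAt ℝ ((γ j).inChart x) (extChartAt (𝓡 m) x x)) (t : OnePoint ℝ)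
    (u v : TangentSpace (𝓡 m) x) :
    (veroneseForm γ t).d x u v = ∑ j, veroneseCoeff n t j * (γ j).d x u v := by
  have h1 : (veroneseForm γ t).inChart x =
      fun z => ∑ j, veroneseCoeff n t j • (γ j).inChart x z := by
    funext z
    ext w
    refine (veroneseForm_apply γ t _ _).trans ?_
    simp only [sum_apply, smul_apply, smul_eq_mul]
    rfl
  have h2 : HasFDerivAt ((veroneseForm γ t).inChart x)
      (∑ j, veroneseCoeff n t j • fderiv ℝ ((γ j).inChart x) (extChartAt (𝓡 m) x x))
      (extChartAt (𝓡 m) x x) := by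
    rw [h1]
    exact HasFDerivAt.fun_sum fun j _ => (hγ j).hasFDerivAt.fun_const_smul _
  have hsum : ∀ (A : Fin (n + 1) →
      EuclideanSpace ℝ (Fin m) →L[ℝ] EuclideanSpace ℝ (Fin m) →L[ℝ] ℝ) a b,
      (∑ j, veroneseCoeff n t j • A j) a b - (∑ j, veroneseCoeff n t j • A j) b a =
        ∑ j, veroneseCoeff n t j * (A j a b - A j b a) := by
    intro A a b
    simp [sum_apply, mul_sub]
  simp only [OneForm.d, h2.fderiv]
  exact hsum _ _ _

theorem eq_zero_of_forall_coframe_apply_eq_zero {ι : Type*} [Fintype ι]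
    (hcard : Fintype.card ι = m) {x : M} {γ : ι → TangentSpace (𝓡 m) x →L[ℝ] ℝ}
    (hγ : LinearIndependent ℝ γ) {v : TangentSpace (𝓡 m) x} (hv : ∀ p, γ p v = 0) : v = 0 := by
  let T : EuclideanSpace ℝ (Fin m) →ₗ[ℝ] ι → ℝ :=
    LinearMap.pi fun p => (γ p : TangentSpace (𝓡 m) x →ₗ[ℝ] ℝ)
  have hT : Function.Surjective T := by
    intro c
    obtain ⟨v, hv⟩ := exists_forall_apply_eq_of_linearIndependent hγ c
    exact ⟨v, funext hv⟩
  have hinj : Function.Injective T :=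
    (LinearMap.injective_iff_surjective_of_finrank_eq_finrank (by simp [hcard])).2 hT
  exact hinj ((funext hv : T v = 0).trans (map_zero T).symm)

end Main

end Veronese

theorem theorem2 (k n : ℕ) {M : Type*} [TopologicalSpace M]
    [ChartedSpace (EuclideanSpace ℝ (Fin (k * (n + 1)))) M]
    [IsManifold (𝓡 (k * (n + 1))) ω M]
    (w : OnePoint ℝ → Veronese.TangentDistribution (k * (n + 1)) M k)
    (hw : Veronese.IsGeneralizedVeroneseCurve n w)
    (a : Fin (n + 3) → OnePoint ℝ) (ha : Function.Injective a)
    (hint : ∀ j, (w (a j)).IsIntegrable) :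
    Veronese.IsGeneralizedVeroneseWeb n w := by
  refine ⟨hw, fun t => Veronese.TangentDistribution.isIntegrable_of_d_eq_zero fun x => ?_⟩
  obtain ⟨U, hU, hxU, γ, hγ, hli, hframe⟩ := hw x
  refine ⟨U, hU, hxU, _, hframe t, fun y hy i u hu v hv => ?_⟩
  have hdiff : ∀ j, DifferentiableAt ℝ ((γ i j).inChart y)
      (extChartAt (𝓡 (k * (n + 1))) y y) := fun j =>
    ((hγ i j).contDiffAt_inChart hU hy (mem_chart_source _ y)).differentiableAt (by simp)
  have hmem : ∀ s (z : TangentSpace (𝓡 (k * (n + 1))) y), z ∈ (w s).fiber y ↔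
      ∀ i, ∑ j, Veronese.veroneseCoeff n s j * γ i j y z = 0 := by
    intro s z
    rw [(hframe s).mem_iff y hy]
    simp only [Veronese.veroneseForm_apply]
  rw [Veronese.OneForm.d_veroneseForm hdiff]
  refine Veronese.bilin_vanish_on_veronese_kernel
    (l := fun i j => (γ i j y : TangentSpace (𝓡 (k * (n + 1))) y →ₗ[ℝ] ℝ))
    (fun z hz => ?_) (fun c => ?_) (fun j => (γ i j).dBilin y) ha
    (fun r u' v' hu' hv' => ?_) t u v ((hmem t u).1 hu) ((hmem t v).1 hv)
  · exact Veronese.eq_zero_of_forall_coframe_apply_eq_zero (by simp) (hli y hy)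
      fun p => hz p.1 p.2
  · obtain ⟨z, hz⟩ := Veronese.exists_forall_apply_eq_of_linearIndependent (hli y hy)
      fun p => c p.1 p.2
    exact ⟨z, fun i j => hz (i, j)⟩
  -- The frame witnessing integrability of `w (a r)` need not be `γ (a r)`; `d_eq_zero` applies to
  -- any analytic form vanishing on the distribution.
  · have h := (hint r).d_eq_zero hU ((hframe (a r)).analyticOn i)
      (fun p hp z hz => ((hframe (a r)).mem_iff p hp z).1 hz i) hy
      ((hmem (a r) u').2 hu') ((hmem (a r) v').2 hv')
    rwa [Veronese.OneForm.d_veroneseForm hdiff] at h
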